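/- Let $\mathcal K$ be a finite non-empty set of keys, $\mathcal H$ a finite-dimensional Hilbert space with a fixed orthonormal basis $\{|m\rangle\}$, and $\mathcal C$ the finite-dimensional Hilbert space of the transmitted system. For each $k\in\mathcal K$ let $\mathcal E_k$ (encoding, from $\mathcal H$ to $\mathcal C$) and $\mathcal D_k$ (decoding, from $\mathcal C$ to $\mathcal H_2\otimes\mathcal H$, where $\mathcal H_2$ has basis $|\mathrm{ACC}\rangle,|\mathrm{REJ}\rangle$) be quantum operations. An attack is a quantum operation $\mathcal A$ from $\mathcal C$ to $\mathcal C\otimes\mathbb C^d$, for any $d$, which does not depend on $k$; the first factor is sent on to Bob and Eve keeps the second. The code $(\mathcal E_k,\mathcal D_k)_k$ is a quantum authentication scheme with error $\epsilon$ if for all unit vectors $|\psi\rangle\in\mathcal H$: (completeness) $\mathcal D_k(\mathcal E_k(|\psi\rangle\langle\psi|))=|\mathrm{ACC}\rangle\langle\mathrm{ACC}|\otimes|\psi\rangle\langle\psi|$ for every $k$; and (soundness) for every attack $\mathcal A$, $$\frac1{|\mathcal K|}\sum_k\mathrm{Tr}\big[\Pi(\psi)\,\mathcal D_k\big(\mathrm{Tr}_{\mathrm{Eve}}\,\mathcal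 A(\mathcal E_k(|\psi\rangle\langle\psi|))\big)\big]\le\epsilon,\qquad \Pi(\psi)=|\mathrm{ACC}\rangle\langle\mathrm{ACC}|\otimes(1-|\psi\rangle\langle\psi|).$$ Theorem. Suppose that $(\mathcal E_k,\mathcal D_k)_k$ is a quantum authentication scheme with error $\epsilon\ge 0$, and put $\delta=\frac{15}{2}\epsilon^{1/6}$. Use it to send classical messages as basis states, $\sigma_k(m)=\mathcal E_k(|m\rangle\langle m|)$. Then $\sigma_k(m)$ is an uncloneable encryption scheme with error (at most) $\delta$; that is, with $D(X,Y)=\frac12\mathrm{Tr}|X-Y|$: (1) for all messages $m\ne m'$, $D(\sigma(m),\sigma(m'))\le\delta$, where $\sigma(m)=\frac1{|\mathcal K|}\sum_k\sigma_k(m)$; (2) for all messages $m\ne m'$ and every attack $\mathcal A$, for a fraction at least $1-\delta$ of the keys $k\in\mathcal K$, $$D\big(P_k(m)\rho_k(m),\,P_k(m')\rho_k(m')\big)\le\delta,$$ where $P_k(m)$ is the probability that Bob, decoding with $\mathcal D_k$ after the attack on $\sigma_k(m)$, obtains $\mathrm{ACC}$, and $\rho_k(m)$ is Eve's residual density matrix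 conditioned on this outcome (with $P_k(m)\rho_k(m)=0$ if $P_k(m)=0$). -/

import Mathlib

open scoped MatrixOrder Kronecker

noncomputable section

namespace UncloneableEncryption

/-! A quantum system is given by a finite type `a` labelling its standard basis: its Hilbert space
is `ℂ^a`, its operators are `Matrix a a ℂ`, and the tensor product of `a` and `b` is `a × b`. -/

/-- Linear maps between operator spaces. -/
abbrev SuperOp (a b : Type*) := Matrix a a ℂ →ₗ[ℂ] Matrix b b ℂ

/-- Quantum operations (completely positive and trace preserving maps), in operator-sum form:
`Φ X = ∑ i, Kᵢ X Kᵢ†` with `∑ i, Kᵢ† Kᵢ = 1`. -/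
def IsQuantumOperation {a b : Type*} [Fintype a] [DecidableEq a] [Fintype b]
    (Φ : SuperOp a b) : Prop :=
  ∃ (r : ℕ) (V : Fin r → Matrix b a ℂ),
    (∀ X, Φ X = ∑ i, V i * X * (V i).conjTranspose) ∧ ∑ i, (V i).conjTranspose * V i = 1

/-- `Φ ⊗ id`: the superoperator `Φ` applied to the first factor of `a × e`. -/
def onFirst {a b e : Type*} (Φ : SuperOp a b) (X : Matrix (a × e) (a × e) ℂ) :
    Matrix (b × e) (b × e) ℂ :=
  Matrix.of fun p q => Φ (Matrix.of fun i j => X (i, p.2) (j, q.2)) p.1 q.1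

/-- Partial trace over the second factor. -/
def traceSecond (b e : Type*) [Fintype e] : SuperOp (b × e) b where
  toFun X := Matrix.of fun i j => ∑ x, X (i, x) (j, x)
  map_add' X Y := by
    ext i j
    simp [Finset.sum_add_distrib]
  map_smul' c X := by
    ext i j
    simp [Finset.mul_sum]

/-- Trace distance `D(X, Y) = (1/2) Tr |X - Y|`, with `|Z| = (Z† Z)^(1/2)`. -/
def traceDist {a : Type*} [Fintype a] [DecidableEq a] (X Y : Matrix a a ℂ) : ℝ :=
  (1 / 2) * (Matrix.trace (CFC.abs (X - Y))).re

/-- The operator `|ψ⟩⟨ψ|`. -/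
def ketbra {a : Type*} (ψ : EuclideanSpace ℂ a) : Matrix a a ℂ :=
  Matrix.vecMulVec ψ.ofLp (star ψ.ofLp)

/-- The basis state `|m⟩`. -/
def ket {a : Type*} [DecidableEq a] (m : a) : EuclideanSpace ℂ a :=
  EuclideanSpace.single m 1

/-- The basis of the two-dimensional space holding Bob's verdict. -/
inductive Verdict where
  | acc
  | rej
  deriving DecidableEq

instance : Fintype Verdict where
  elems := {Verdict.acc, Verdict.rej}
  complete := by
    intro v
    cases v <;> simp

/-- A general attack by Eve on the transmitted system `C`, with a register of dimension `d` that
she keeps: the first output factor is sent on to Bob, the second one remains with Eve. -/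
structure Attack (C : Type*) [Fintype C] [DecidableEq C] (d : ℕ) where
  /-- the superoperator that Eve applies -/
  toMap : SuperOp C (C × Fin d)
  isOp : IsQuantumOperation toMap

section Encryption

variable {K Msg C : Type*} [Fintype K] [Fintype C] [DecidableEq C]

/-- The transmitted density matrix, averaged over the uniformly distributed key. -/
def averageState (σ : K → Msg → Matrix C C ℂ) (m : Msg) : Matrix C C ℂ :=
  (Fintype.card K : ℂ)⁻¹ • ∑ k, σ k m

/-- An encryption scheme with error `δ` for classical messages. -/
def IsEncryption (σ : K → Msg → Matrix C C ℂ) (δ : ℝ) : Prop :=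
  ∀ m m' : Msg, m ≠ m' → traceDist (averageState σ m) (averageState σ m') ≤ δ

/-- Eve's subnormalized state in the event `ACC`, when Bob performs the checking procedure `check`
on his part of the attacked state. -/
def acceptedState (check : SuperOp C Verdict) {d : ℕ} (A : Attack C d) (s : Matrix C C ℂ) :
    Matrix (Fin d) (Fin d) ℂ :=
  Matrix.of fun x y => onFirst check (A.toMap s) (Verdict.acc, x) (Verdict.acc, y)

/-- The probability `P` that Bob accepts when `s` is sent and attacked. -/
def acceptProb (check : SuperOp C Verdict) {d : ℕ} (A : Attack C d) (s : Matrix C C ℂ) : ℝ :=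
  (acceptedState check A s).trace.re

/-- Eve's residual density matrix `ρ`, conditioned on `ACC` (zero if Bob never accepts). -/
def residualState (check : SuperOp C Verdict) {d : ℕ} (A : Attack C d) (s : Matrix C C ℂ) :
    Matrix (Fin d) (Fin d) ℂ :=
  (acceptProb check A s)⁻¹ • acceptedState check A s

/-- The encoding `σ` of classical messages, with Bob's checking procedures `check k`, is an
uncloneable encryption scheme with error `δ`. The attack is fixed before the key. -/
structure IsUncloneableEncryption (σ : K → Msg → Matrix C C ℂ)
    (check : K → SuperOp C Verdict) (δ : ℝ) : Prop where
  encrypts : IsEncryption σ δ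
  uncloneable : ∀ m m' : Msg, m ≠ m' → ∀ (d : ℕ) (A : Attack C d),
    1 - δ ≤ (Nat.card {k : K //
      traceDist
        (acceptProb (check k) A (σ k m) • residualState (check k) A (σ k m))
        (acceptProb (check k) A (σ k m') • residualState (check k) A (σ k m')) ≤ δ} : ℝ)
      / (Fintype.card K : ℝ)

end Encryption

/-- Keyed encoding and decoding operations for states of the system `H`, transmitted in `C`. -/
structure QuantumCode (K H C : Type*) [Fintype H] [DecidableEq H] [Fintype C] [DecidableEq C] where
  /-- Alice's encoding with key `k` -/
  encode : K → SuperOp H C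
  encode_isOp : ∀ k, IsQuantumOperation (encode k)
  /-- Bob's decoding with key `k` -/
  decode : K → SuperOp C (Verdict × H)
  decode_isOp : ∀ k, IsQuantumOperation (decode k)

namespace QuantumCode

variable {K H C : Type*} [Fintype H] [DecidableEq H] [Fintype C] [DecidableEq C]

/-- The operator `|ACC⟩⟨ACC|`. -/
def accProj : Matrix Verdict Verdict ℂ := ketbra (ket Verdict.acc)

/-- The projector `Π(ψ)` onto the states `|ACC⟩ ⊗ |φ⟩` with `φ` orthogonal to the unit vector
`ψ`. -/
def badProj (ψ : EuclideanSpace ℂ H) : Matrix (Verdict × H) (Verdict × H) ℂ :=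
  accProj ⊗ₖ (1 - ketbra ψ)

/-- The state that Eve sends on to Bob when Alice encodes `|ψ⟩` with key `k`. -/
def bobState (S : QuantumCode K H C) {d : ℕ} (A : Attack C d) (k : K)
    (ψ : EuclideanSpace ℂ H) : Matrix C C ℂ :=
  traceSecond C (Fin d) (A.toMap (S.encode k (ketbra ψ)))

/-- A quantum authentication scheme with error `ε`. -/
structure IsAuthentication [Fintype K] (S : QuantumCode K H C) (ε : ℝ) : Prop where
  /-- without tampering, Bob accepts and recovers the state that was sent -/
  complete : ∀ (k : K) (ψ : EuclideanSpace ℂ H), ‖ψ‖ = 1 →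
    S.decode k (S.encode k (ketbra ψ)) = accProj ⊗ₖ ketbra ψ
  /-- for every attack, the average probability that Bob accepts a wrong state is at most `ε` -/
  sound : ∀ (ψ : EuclideanSpace ℂ H), ‖ψ‖ = 1 → ∀ (d : ℕ) (A : Attack C d),
    (1 / (Fintype.card K : ℝ)) *
      ∑ k, (Matrix.trace (badProj ψ * S.decode k (S.bobState A k ψ))).re ≤ ε

/-- Encoding of classical messages as basis states: `σ_k(m)` is the encoding of `|m⟩`. -/
def encodeBasis (S : QuantumCode K H C) (k : K) (m : H) : Matrix C C ℂ :=
  S.encode k (ketbra (ket m))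

/-- Bob's check: he decodes and keeps only the verdict. -/
def verdict (S : QuantumCode K H C) (k : K) : SuperOp C Verdict :=
  traceSecond Verdict H ∘ₗ S.decode k

end QuantumCode

end UncloneableEncryption

end

/-! Write φ± = (|m⟩ ± |m'⟩)/√2. Both claims come from testing soundness on φ+ and looking only at
the orthogonal wrong answer φ-.

Encryption. Since |m⟩⟨m| - |m'⟩⟨m'| = |φ+⟩⟨φ-| + |φ-⟩⟨φ+|, an observable that distinguishes the two
messages detects coherence between φ+ and φ-. Let W be the sign of σ(m) - σ(m'). It is a Hermitian
unitary that does not depend on the key, so applying it is a legitimate attack. Completeness and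
Cauchy-Schwarz (`norm_trace_mul_sq_le`) show that this attack turns φ+ into an accepted φ- with
probability at least the square of half the expectation of W on σ_k(m) - σ_k(m'). Averaging over the
keys gives D(σ(m), σ(m'))² ≤ ε (`traceDist_averageState_sq_le`).

Uncloneability. Fix a key and take Kraus operators T_i of encoding, attack and decoding together.
Eve's accepted state for m is M M†, where M has entries ⟨ACC,h,x|T_i|m⟩, with x indexing Eve and
(i,h) the discarded systems. Soundness on |m⟩ and |m'⟩ makes the branches with a wrong h small;
soundness on φ+ then forces the branch m → m to be close to the branch m' → m'. Swapping the columns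
m and m' of the second matrix leaves its Gram matrix unchanged and brings it close to the first, so
the accepted states are close too (`traceDist_acceptedAmplitude_sq_le`). Only soundness is used
here. The squared distance averages to at most 20ε over the keys, and Chebyshev's inequality
finishes. -/

namespace UncloneableEncryption

open Matrix
open scoped ComplexOrder

/-! ### Trace and trace-norm inequalities for matrices -/

section MatrixInequalities

variable {n p ι : Type*} [Fintype n] [Fintype p] [Fintype ι]

theorem trace_mul_re_nonneg {A B : Matrix n n ℂ} (hA : A.PosSemidef) (hB : B.PosSemidef) :
    0 ≤ (trace (A * B)).re := by
  classical
  obtain ⟨R, rfl⟩ := CStarAlgebra.nonneg_iff_eq_star_mul_self.1 hA.nonneg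
  rw [star_eq_conjTranspose, Matrix.mul_assoc, Matrix.trace_mul_comm]
  exact (Complex.le_def.1 (hB.mul_mul_conjTranspose_same R).trace_nonneg).1

theorem trace_conjTranspose_mul_self_eq_sum (A : Matrix n p ℂ) :
    trace (Aᴴ * A) = ((∑ j, ∑ i, ‖A i j‖ ^ 2 : ℝ) : ℂ) := by
  simp only [Matrix.trace, Matrix.diag, Matrix.mul_apply, Matrix.conjTranspose_apply]
  push_cast
  refine Finset.sum_congr rfl fun j _ => Finset.sum_congr rfl fun i _ => ?_
  exact Complex.conj_mul' (A i j)

theorem eq_zero_of_trace_conjTranspose_mul_self_re_eq_zero {A : Matrix n p ℂ}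
    (h : (trace (Aᴴ * A)).re = 0) : A = 0 := by
  rw [trace_conjTranspose_mul_self_eq_sum, Complex.ofReal_re] at h
  have h1 := (Finset.sum_eq_zero_iff_of_nonneg fun j _ => Finset.sum_nonneg fun i _ =>
    sq_nonneg ‖A i j‖).1 h
  ext i j
  have h2 := (Finset.sum_eq_zero_iff_of_nonneg fun i _ => sq_nonneg ‖A i j‖).1
    (h1 j (Finset.mem_univ _)) i (Finset.mem_univ _)
  simpa using h2

/-- The Cauchy-Schwarz inequality for families of matrices. -/
theorem norm_sum_trace_conjTranspose_mul_sq_le (A B : ι → Matrix n p ℂ) :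
    ‖∑ i, trace ((A i)ᴴ * B i)‖ ^ 2 ≤
      (∑ i, trace ((A i)ᴴ * A i)).re * (∑ i, trace ((B i)ᴴ * B i)).re := by
  have key : ∀ F : ι → Matrix n p ℂ, (∑ i, trace ((F i)ᴴ * F i)).re =
      ∑ t : ι × p × n, ‖F t.1 t.2.2 t.2.1‖ ^ 2 := by
    intro F
    simp only [trace_conjTranspose_mul_self_eq_sum, Complex.re_sum, Complex.ofReal_re,
      Fintype.sum_prod_type]
  have h1 : ‖∑ i, trace ((A i)ᴴ * B i)‖ ≤
      ∑ t : ι × p × n, ‖A t.1 t.2.2 t.2.1‖ * ‖B t.1 t.2.2 t.2.1‖ := by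
    have : ∑ i, trace ((A i)ᴴ * B i) =
        ∑ t : ι × p × n, star (A t.1 t.2.2 t.2.1) * B t.1 t.2.2 t.2.1 := by
      simp only [Matrix.trace, Matrix.diag, Matrix.mul_apply, Matrix.conjTranspose_apply,
        Fintype.sum_prod_type]
    rw [this]
    refine (norm_sum_le _ _).trans (le_of_eq (Finset.sum_congr rfl fun t _ => ?_))
    rw [norm_mul, norm_star]
  rw [key A, key B]
  exact (pow_le_pow_left₀ (norm_nonneg _) h1 2).trans (Finset.sum_mul_sq_le_sq_mul_sq _ _ _)

/-- The trace norm of a Hermitian matrix is attained on its sign. -/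
theorem exists_unitary_trace_abs [DecidableEq n] {Z : Matrix n n ℂ} (hZ : Z.IsHermitian) :
    ∃ W : Matrix n n ℂ, Wᴴ = W ∧ W * W = 1 ∧ trace (CFC.abs Z) = trace (W * Z) := by
  have hsa : IsSelfAdjoint Z := hZ
  have hfin : (spectrum ℝ Z).Finite := Matrix.finite_real_spectrum
  have hc : ∀ f : ℝ → ℝ, ContinuousOn f (spectrum ℝ Z) := fun f => hfin.continuousOn f
  -- The sign is taken to be 1, not 0, at 0, so that its square is 1 on the kernel of `Z` as well.
  let s : ℝ → ℝ := fun x => if 0 ≤ x then 1 else -1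
  refine ⟨cfc s Z, ?_, ?_, ?_⟩
  · exact (cfc_predicate s Z : IsSelfAdjoint _)
  · rw [← cfc_mul s s Z (hc _) (hc _)]
    have : (fun x => s x * s x) = fun _ => (1 : ℝ) := by
      funext x
      by_cases hx : 0 ≤ x <;> simp [s, hx]
    rw [this, cfc_const_one ℝ Z]
  · rw [CFC.abs_eq_cfc_norm Z]
    have : cfc s Z * Z = cfc (fun x => s x * x) Z := by
      rw [cfc_mul s (fun x => x) Z (hc _) (hc _), cfc_id' ℝ Z]
    rw [this]
    congr 2
    funext x
    by_cases hx : 0 ≤ x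
    · simp [s, hx, abs_of_nonneg hx]
    · simp [s, hx, abs_of_neg (not_le.1 hx)]

theorem one_sub_posSemidef_of_involution [DecidableEq n] {W : Matrix n n ℂ} (h1 : Wᴴ = W)
    (h2 : W * W = 1) : (1 - W).PosSemidef := by
  have : 1 - W = (1 / 2 : ℝ) • ((1 - W)ᴴ * (1 - W)) := by
    rw [conjTranspose_sub, conjTranspose_one, h1, sub_mul, mul_sub, mul_sub, h2]
    simp only [one_mul, mul_one]
    module
  rw [this]
  exact (posSemidef_conjTranspose_mul_self _).smul (by norm_num)

theorem trace_mul_re_mem_Icc_of_involution [DecidableEq n] {W s : Matrix n n ℂ} (h1 : Wᴴ = W)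
    (h2 : W * W = 1) (hs : s.PosSemidef) (hs1 : s.trace = 1) :
    (trace (W * s)).re ∈ Set.Icc (-1) 1 := by
  have a := trace_mul_re_nonneg (one_sub_posSemidef_of_involution h1 h2) hs
  have b := trace_mul_re_nonneg (one_sub_posSemidef_of_involution (W := -W)
    (by rw [conjTranspose_neg, h1]) (by rw [neg_mul_neg, h2])) hs
  rw [sub_mul, one_mul, trace_sub, hs1, Complex.sub_re, Complex.one_re] at a
  rw [sub_mul, one_mul, trace_sub, hs1, Complex.sub_re, Complex.one_re, neg_mul, trace_neg,
    Complex.neg_re] at b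
  constructor <;> linarith

/-- Trace distance of two Gram matrices. -/
theorem traceDist_mul_conjTranspose_sq_le [DecidableEq n] (U V : Matrix n p ℂ)
    (hU : (trace (Uᴴ * U)).re ≤ 1) (hV : (trace (Vᴴ * V)).re ≤ 1) :
    traceDist (U * Uᴴ) (V * Vᴴ) ^ 2 ≤ (trace ((U - V)ᴴ * (U - V))).re := by
  obtain ⟨W, h1, h2, h3⟩ := exists_unitary_trace_abs
    ((isHermitian_mul_conjTranspose_self U).sub (isHermitian_mul_conjTranspose_self V))
  -- Expanding the right side leaves two cross terms, which are complex conjugates of each other and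
  -- cancel in the real part.
  have e : (trace (W * (U * Uᴴ - V * Vᴴ))).re = (trace ((U - V)ᴴ * (W * (U + V)))).re := by
    have c : (trace (Vᴴ * (W * U))).re = (trace (Uᴴ * (W * V))).re := by
      have : (Vᴴ * (W * U))ᴴ = Uᴴ * (W * V) := by
        simp only [conjTranspose_mul, conjTranspose_conjTranspose, h1, Matrix.mul_assoc]
      rw [← this, trace_conjTranspose]
      simp
    rw [conjTranspose_sub, Matrix.sub_mul, Matrix.mul_add, Matrix.mul_add, Matrix.mul_add,
      Matrix.mul_sub, ← Matrix.mul_assoc, ← Matrix.mul_assoc, trace_sub, trace_sub,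
      Matrix.trace_mul_comm _ Uᴴ, Matrix.trace_mul_comm _ Vᴴ, trace_add, trace_add]
    simp only [Complex.sub_re, Complex.add_re]
    linarith
  have cs := norm_sum_trace_conjTranspose_mul_sq_le (ι := Unit) (fun _ => U - V)
    (fun _ => W * (U + V))
  simp only [Finset.univ_unique, Finset.sum_singleton] at cs
  have e2 : (W * (U + V))ᴴ * (W * (U + V)) = (U + V)ᴴ * (U + V) := by
    rw [conjTranspose_mul, h1, Matrix.mul_assoc, ← Matrix.mul_assoc W, h2, Matrix.one_mul]
  have nn : ∀ X : Matrix n p ℂ, 0 ≤ (trace (Xᴴ * X)).re := fun X =>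
    (Complex.le_def.1 (posSemidef_conjTranspose_mul_self X).trace_nonneg).1
  -- The parallelogram law bounds ‖U + V‖² by 4; its root 2 is absorbed by the factor 1/2 in the
  -- trace distance.
  have e3 : (trace ((U + V)ᴴ * (U + V))).re ≤ 4 := by
    have par : (trace ((U + V)ᴴ * (U + V))).re + (trace ((U - V)ᴴ * (U - V))).re =
        2 * (trace (Uᴴ * U)).re + 2 * (trace (Vᴴ * V)).re := by
      simp only [conjTranspose_sub, conjTranspose_add, Matrix.sub_mul, Matrix.add_mul,
        Matrix.mul_sub, Matrix.mul_add, trace_add, trace_sub, Complex.add_re, Complex.sub_re]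
      ring
    linarith [nn (U - V)]
  rw [e2] at cs
  have e4 := Complex.abs_re_le_norm (trace ((U - V)ᴴ * (W * (U + V))))
  have e5 := pow_le_pow_left₀ (abs_nonneg _) e4 2
  rw [sq_abs] at e5
  have e6 := mul_le_mul_of_nonneg_left e3 (nn (U - V))
  rw [traceDist, h3, e]
  nlinarith

end MatrixInequalities

/-! ### Operator-sum calculus for quantum operations -/

section Kraus

/-- `Φ ⊗ id` as a superoperator. -/
theorem exists_onFirst_eq {a b e : Type*} (Φ : SuperOp a b) :
    ∃ Φ' : SuperOp (a × e) (b × e), ∀ X, Φ' X = onFirst Φ X := by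
  refine ⟨⟨⟨onFirst Φ, fun X Y => ?_⟩, fun z X => ?_⟩, fun X => rfl⟩
  · ext p q
    have : (Matrix.of fun i j => (X + Y) (i, p.2) (j, q.2)) =
        (Matrix.of fun i j => X (i, p.2) (j, q.2)) +
        (Matrix.of fun i j => Y (i, p.2) (j, q.2)) := rfl
    exact (congrFun₂ ((congrArg Φ this).trans (map_add Φ _ _)) p.1 q.1)
  · ext p q
    have : (Matrix.of fun i j => (z • X) (i, p.2) (j, q.2)) =
        z • (Matrix.of fun i j => X (i, p.2) (j, q.2)) := rfl
    exact (congrFun₂ ((congrArg Φ this).trans (map_smul Φ _ _)) p.1 q.1)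

variable {a b c e ι κ : Type*} [Fintype a] [DecidableEq a] [Fintype b] [Fintype c]
  [Fintype e] [Fintype ι] [Fintype κ]

/-- `V` is a family of Kraus operators for the quantum operation `Φ`. -/
structure IsKraus (Φ : SuperOp a b) (V : ι → Matrix b a ℂ) : Prop where
  apply_eq : ∀ X, Φ X = ∑ i, V i * X * (V i)ᴴ
  sum_eq_one : ∑ i, (V i)ᴴ * V i = 1

theorem IsQuantumOperation.exists_isKraus {Φ : SuperOp a b} (h : IsQuantumOperation Φ) :
    ∃ (r : ℕ) (V : Fin r → Matrix b a ℂ), IsKraus Φ V := by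
  obtain ⟨r, V, h1, h2⟩ := h
  exact ⟨r, V, h1, h2⟩

namespace IsKraus

variable {Φ : SuperOp a b} {V : ι → Matrix b a ℂ} {Ψ : SuperOp b c} {U : κ → Matrix c b ℂ}

theorem comp [DecidableEq b] (hΨ : IsKraus Ψ U) (hΦ : IsKraus Φ V) :
    IsKraus (Ψ ∘ₗ Φ) fun t : κ × ι => U t.1 * V t.2 where
  apply_eq X := by
    rw [LinearMap.comp_apply, hΨ.apply_eq, hΦ.apply_eq, Fintype.sum_prod_type]
    refine Finset.sum_congr rfl fun j _ => ?_
    rw [Matrix.mul_sum, Matrix.sum_mul]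
    refine Finset.sum_congr rfl fun i _ => ?_
    simp only [conjTranspose_mul, Matrix.mul_assoc]
  sum_eq_one := by
    rw [Fintype.sum_prod_type_right]
    rw [← hΦ.sum_eq_one]
    refine Finset.sum_congr rfl fun i _ => ?_
    have : ∀ j, (U j * V i)ᴴ * (U j * V i) = (V i)ᴴ * (((U j)ᴴ * U j) * V i) := fun j => by
      simp only [conjTranspose_mul, Matrix.mul_assoc]
    simp only [this]
    rw [← Matrix.mul_sum, ← Matrix.sum_mul, hΨ.sum_eq_one, Matrix.one_mul]

theorem trace_apply (hΦ : IsKraus Φ V) (X : Matrix a a ℂ) : trace (Φ X) = trace X := by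
  rw [hΦ.apply_eq, trace_sum]
  have : ∀ i, trace (V i * X * (V i)ᴴ) = trace ((V i)ᴴ * V i * X) := fun i => by
    rw [Matrix.trace_mul_comm, Matrix.mul_assoc]
  simp only [this]
  rw [← trace_sum, ← Matrix.sum_mul, hΦ.sum_eq_one, Matrix.one_mul]

theorem posSemidef_apply (hΦ : IsKraus Φ V) {X : Matrix a a ℂ} (hX : X.PosSemidef) :
    (Φ X).PosSemidef := by
  rw [hΦ.apply_eq]
  exact posSemidef_sum _ fun i _ => hX.mul_mul_conjTranspose_same _

theorem apply_conjTranspose (hΦ : IsKraus Φ V) (X : Matrix a a ℂ) : Φ Xᴴ = (Φ X)ᴴ := by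
  rw [hΦ.apply_eq, hΦ.apply_eq, conjTranspose_sum]
  refine Finset.sum_congr rfl fun i _ => ?_
  simp only [conjTranspose_mul, conjTranspose_conjTranspose, Matrix.mul_assoc]

theorem exists_onFirst [DecidableEq e] (hΦ : IsKraus Φ V) :
    ∃ Φ' : SuperOp (a × e) (b × e), (∀ X, Φ' X = onFirst Φ X) ∧
      IsKraus Φ' fun i => V i ⊗ₖ (1 : Matrix e e ℂ) := by
  obtain ⟨Φ', h⟩ := exists_onFirst_eq (e := e) Φ
  refine ⟨Φ', h, fun X => ?_, ?_⟩
  · rw [h]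
    ext p q
    simp only [onFirst, of_apply, hΦ.apply_eq, Matrix.sum_apply]
    refine Finset.sum_congr rfl fun i _ => ?_
    simp [Matrix.mul_apply, kroneckerMap_apply, Fintype.sum_prod_type, Matrix.one_apply,
      conjTranspose_apply, Finset.sum_mul, apply_ite]
  · have : ∀ i, (V i ⊗ₖ (1 : Matrix e e ℂ))ᴴ * (V i ⊗ₖ (1 : Matrix e e ℂ)) =
        ((V i)ᴴ * V i) ⊗ₖ (1 : Matrix e e ℂ) := fun i => by
      rw [conjTranspose_kronecker, conjTranspose_one, ← mul_kronecker_mul, Matrix.one_mul]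
    simp only [this]
    rw [← one_kronecker_one (m := a) (n := e), ← hΦ.sum_eq_one]
    ext p q
    simp [Matrix.sum_apply, kroneckerMap_apply, Finset.sum_mul]

end IsKraus

/-- Bob's decoding does not touch Eve's register. This links the soundness condition, which discards
that register before decoding, to the accepted state, which keeps it. -/
theorem traceSecond_onFirst {a b e : Type*} [Fintype e] (Φ : SuperOp a b) (X : Matrix (a × e) (a × e) ℂ) :
    traceSecond b e (onFirst Φ X) = Φ (traceSecond a e X) := by
  have : traceSecond a e X = ∑ x, Matrix.of fun i j => X (i, x) (j, x) := by
    ext i j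
    simp [traceSecond, Matrix.sum_apply]
  rw [this, map_sum]
  ext i j
  simp [traceSecond, onFirst, Matrix.sum_apply]

end Kraus

end UncloneableEncryption

namespace UncloneableEncryption

open Matrix
open scoped ComplexOrder

/-! ### Pure states and superpositions of two basis states -/

section PureStates

variable {a p : Type*} [Fintype a]

theorem ketbra_apply {a : Type*} (ψ : EuclideanSpace ℂ a) (i j : a) : ketbra ψ i j = ψ i * star (ψ j) := rfl

theorem ketbra_eq_col_mul {a : Type*} (ψ : EuclideanSpace ℂ a) :
    ketbra ψ = replicateCol Unit ψ.ofLp * (replicateCol Unit ψ.ofLp)ᴴ := by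
  ext i j
  simp [ketbra_apply, Matrix.mul_apply]

theorem conjTranspose_ketbra {a : Type*} (ψ : EuclideanSpace ℂ a) : (ketbra ψ)ᴴ = ketbra ψ := by
  ext i j
  simp [ketbra_apply, mul_comm]

theorem posSemidef_ketbra (ψ : EuclideanSpace ℂ a) : (ketbra ψ).PosSemidef :=
  posSemidef_vecMulVec_self_star _

theorem ketbra_mul_ketbra (φ ψ : EuclideanSpace ℂ a) :
    ketbra φ * ketbra ψ = inner ℂ φ ψ • vecMulVec φ.ofLp (star ψ.ofLp) := by
  rw [ketbra, ketbra, vecMulVec_mul_vecMulVec, EuclideanSpace.inner_eq_star_dotProduct,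
    dotProduct_comm, ← smul_vecMulVec]
  ext i j
  simp [vecMulVec_apply]
  ring

theorem ketbra_mul_self {ψ : EuclideanSpace ℂ a} (h : ‖ψ‖ = 1) :
    ketbra ψ * ketbra ψ = ketbra ψ := by
  rw [ketbra_mul_ketbra, inner_self_eq_norm_sq_to_K, h]
  simp [ketbra]

theorem trace_ketbra {ψ : EuclideanSpace ℂ a} (h : ‖ψ‖ = 1) : trace (ketbra ψ) = 1 := by
  have : trace (ketbra ψ) = inner ℂ ψ ψ := by
    rw [ketbra, trace_vecMulVec, EuclideanSpace.inner_eq_star_dotProduct]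
  rw [this, inner_self_eq_norm_sq_to_K, h]
  simp

theorem posSemidef_of_isHermitian_of_idempotent {P : Matrix a a ℂ} (h1 : Pᴴ = P)
    (h2 : P * P = P) : P.PosSemidef := by
  rw [← h2]
  nth_rewrite 1 [← h1]
  exact posSemidef_conjTranspose_mul_self P

variable [DecidableEq a]

theorem norm_ket (m : a) : ‖ket m‖ = 1 := by simp [ket]

theorem ket_apply {a : Type*} [DecidableEq a] (m i : a) : ket m i = if i = m then 1 else 0 := by
  simp [ket]

theorem posSemidef_one_sub_ketbra_sub_ketbra {φ ψ : EuclideanSpace ℂ a} (hφ : ‖φ‖ = 1)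
    (hψ : ‖ψ‖ = 1) (h : inner ℂ φ ψ = 0) : (1 - ketbra ψ - ketbra φ).PosSemidef := by
  have h' : inner ℂ ψ φ = 0 := inner_eq_zero_symm.1 h
  refine posSemidef_of_isHermitian_of_idempotent ?_ ?_
  · simp only [conjTranspose_sub, conjTranspose_one, conjTranspose_ketbra]
  · simp only [Matrix.sub_mul, Matrix.mul_sub, ketbra_mul_self hφ, ketbra_mul_self hψ,
      ketbra_mul_ketbra φ ψ, ketbra_mul_ketbra ψ φ, h, h', zero_smul, Matrix.one_mul,
      Matrix.mul_one]
    abel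

theorem one_sub_ketbra_ket (m : a) :
    1 - ketbra (ket m) = ∑ h ∈ Finset.univ.erase m, ketbra (ket h) := by
  have : (1 : Matrix a a ℂ) = ∑ h, ketbra (ket h) := by
    ext i j
    simp [Matrix.sum_apply, ketbra_apply, ket_apply, Matrix.one_apply]
  rw [this, ← Finset.add_sum_erase _ _ (Finset.mem_univ m), add_sub_cancel_left]

/-- The superposition `(|m⟩ + z |m'⟩) / √2`. -/
noncomputable def superposition {a : Type*} [DecidableEq a] (z : ℂ) (m m' : a) : EuclideanSpace ℂ a :=
  ((√2 : ℝ) : ℂ)⁻¹ • (ket m + z • ket m')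

theorem inv_sqrt_two_mul_self : (((√2 : ℝ) : ℂ)⁻¹) * ((√2 : ℝ) : ℂ)⁻¹ = 1 / 2 := by
  rw [← mul_inv, ← Complex.ofReal_mul, Real.mul_self_sqrt (by norm_num)]
  norm_num

theorem inner_superposition {m m' : a} (h : m ≠ m') (y z : ℂ) :
    inner ℂ (superposition y m m') (superposition z m m') = (1 + star y * z) / 2 := by
  have e : inner ℂ (ket m + y • ket m') (ket m + z • ket m') = 1 + star y * z := by
    have e1 : ∀ i j : a, inner ℂ (ket i) (ket j) = if i = j then 1 else 0 := fun i j => by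
      simp [ket, EuclideanSpace.inner_single_left]
    simp only [inner_add_left, inner_add_right, inner_smul_left, inner_smul_right, e1, h, h.symm,
      if_true, if_false, Complex.star_def]
    ring
  rw [superposition, superposition, inner_smul_left, inner_smul_right, e, ← mul_assoc,
    map_inv₀, Complex.conj_ofReal, inv_sqrt_two_mul_self]
  ring

theorem norm_superposition {m m' : a} (h : m ≠ m') {z : ℂ} (hz : ‖z‖ = 1) :
    ‖superposition z m m'‖ = 1 := by
  have e := inner_superposition h z z
  rw [inner_self_eq_norm_sq_to_K] at e
  have : star z * z = 1 := by
    rw [Complex.star_def, Complex.conj_mul', hz]; norm_num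
  rw [this] at e
  have e2 : ‖superposition z m m'‖ ^ 2 = 1 := by
    have : ((‖superposition z m m'‖ ^ 2 : ℝ) : ℂ) = ((1 : ℝ) : ℂ) := by
      push_cast
      rw [show (1 : ℂ) = (1 + 1) / 2 by norm_num]
      exact e
    exact_mod_cast this
  exact (pow_eq_one_iff_of_nonneg (norm_nonneg _) two_ne_zero).1 e2

theorem superposition_apply {a : Type*} [DecidableEq a] (z : ℂ) (m m' i : a) :
    superposition z m m' i = ((√2 : ℝ) : ℂ)⁻¹ * (ket m i + z * ket m' i) := rfl

end PureStates

open QuantumCode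

/-! ### Accepted outcomes and their probabilities -/

section Verdicts

variable {H e : Type*} [Fintype H] [Fintype e]

theorem accProj_conjTranspose : accProjᴴ = accProj := conjTranspose_ketbra _

theorem accProj_mul_self : accProj * accProj = accProj := ketbra_mul_self (norm_ket _)

/-- Orthogonality makes 1 - |ψ⟩⟨ψ| - |φ⟩⟨φ| a projector, so accepting `φ` is one of the bad events
for `ψ`. It is applied with φ- against φ+. -/
theorem trace_accProj_kronecker_ketbra_mul_le [DecidableEq H] {φ ψ : EuclideanSpace ℂ H} (hφ : ‖φ‖ = 1)
    (hψ : ‖ψ‖ = 1) (h : inner ℂ φ ψ = 0)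
    {Y : Matrix (Verdict × H) (Verdict × H) ℂ} (hY : Y.PosSemidef) :
    (trace ((accProj ⊗ₖ ketbra φ) * Y)).re ≤ (trace (badProj ψ * Y)).re := by
  have e : badProj ψ = accProj ⊗ₖ (1 - ketbra ψ - ketbra φ) + accProj ⊗ₖ ketbra φ := by
    rw [← kronecker_add, sub_add_cancel, badProj]
  have := trace_mul_re_nonneg ((posSemidef_ketbra (ket Verdict.acc)).kronecker
    (posSemidef_one_sub_ketbra_sub_ketbra hφ hψ h)) hY
  rw [e, Matrix.add_mul, trace_add, Complex.add_re]
  exact le_add_of_nonneg_left this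

theorem sum_verdict {M : Type*} [AddCommMonoid M] (f : Verdict → M) :
    ∑ v, f v = f Verdict.acc + f Verdict.rej := by
  have : (Finset.univ : Finset Verdict) = {Verdict.acc, Verdict.rej} := rfl
  rw [this, Finset.sum_pair (by simp)]

theorem accProj_apply (v w : Verdict) :
    accProj v w = if v = Verdict.acc ∧ w = Verdict.acc then 1 else 0 := by
  cases v <;> cases w <;> simp [accProj, ketbra_apply, ket_apply]

/-- The state before the partial trace has rank one, so the probability is a sum of squared
amplitudes, one for each basis state of Eve. -/
theorem trace_accProj_kronecker_ketbra_mul_traceSecond (φ ψ : EuclideanSpace ℂ H)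
    (T : Matrix ((Verdict × H) × e) H ℂ) :
    (trace ((accProj ⊗ₖ ketbra φ) *
      traceSecond (Verdict × H) e (T * ketbra ψ * Tᴴ))).re =
      ∑ x, ‖∑ h, star (φ h) * (T *ᵥ ψ.ofLp) ((Verdict.acc, h), x)‖ ^ 2 := by
  set t := T *ᵥ ψ.ofLp with ht
  have e1 : T * ketbra ψ * Tᴴ = vecMulVec t (star t) := by
    rw [ketbra, mul_vecMulVec, vecMulVec_mul, ht, star_mulVec]
  rw [e1]
  have e2 : trace ((accProj ⊗ₖ ketbra φ) *
      traceSecond (Verdict × H) e (vecMulVec t (star t))) =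
      ∑ x, ∑ h, ∑ h', (star (φ h) * t ((Verdict.acc, h), x)) *
        star (star (φ h') * t ((Verdict.acc, h'), x)) := by
    simp only [Matrix.trace, Matrix.diag, Matrix.mul_apply, Fintype.sum_prod_type, sum_verdict,
      kroneckerMap_apply, accProj_apply, ketbra_apply, traceSecond, LinearMap.coe_mk,
      AddHom.coe_mk, of_apply, vecMulVec_apply, Pi.star_apply]
    simp only [and_self, reduceCtorEq, and_false, false_and, if_true, if_false, zero_mul, one_mul,
      Finset.sum_const_zero, add_zero]
    simp only [Finset.mul_sum]
    conv_rhs =>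
      enter [2, x]
      rw [Finset.sum_comm]
    rw [Finset.sum_comm (s := (Finset.univ : Finset e))]
    refine Finset.sum_congr rfl fun h' _ => ?_
    rw [Finset.sum_comm (s := (Finset.univ : Finset e))]
    refine Finset.sum_congr rfl fun h _ => Finset.sum_congr rfl fun x _ => ?_
    rw [star_mul', star_star]
    ring
  rw [e2, Complex.re_sum]
  refine Finset.sum_congr rfl fun x _ => ?_
  rw [← Finset.sum_mul_sum, ← star_sum, Complex.star_def, Complex.mul_conj']
  norm_cast

end Verdicts

/-! ### Coherence detected by an observable yields a transition probability -/

section SingleKey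

variable {a b c p ι κ : Type*} [Fintype a] [DecidableEq a] [Fintype b] [DecidableEq b]
  [Fintype c] [DecidableEq c] [Fintype p] [Fintype ι] [Fintype κ]

/-- If `Ψ ∘ Φ` maps `Y Y†` to a rank one projection `N`, then a disturbance `W` between `Φ` and `Ψ`
takes `X X†` to `N` with probability at least `|tr (W Φ(X Y†))|²`. -/
theorem norm_trace_mul_sq_le {Φ : SuperOp a b} {V : ι → Matrix b a ℂ} {Ψ : SuperOp b c}
    {U : κ → Matrix c b ℂ} (hΦ : IsKraus Φ V) (hΨ : IsKraus Ψ U) {N : Matrix c c ℂ}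
    (h1 : Nᴴ = N) (h2 : N * N = N) (h3 : trace N = 1) (X Y : Matrix a p ℂ)
    (hN : Ψ (Φ (Y * Yᴴ)) = N) (W : Matrix b b ℂ) :
    ‖trace (W * Φ (X * Yᴴ))‖ ^ 2 ≤ (trace (N * Ψ (W * Φ (X * Xᴴ) * Wᴴ))).re := by
  let A : κ × ι → Matrix c p ℂ := fun t => U t.1 * V t.2 * Y
  let B : κ × ι → Matrix c p ℂ := fun t => U t.1 * W * V t.2 * X
  have hA : ∑ t, A t * (A t)ᴴ = N := by
    rw [← hN, ← LinearMap.comp_apply, (hΨ.comp hΦ).apply_eq]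
    refine Finset.sum_congr rfl fun t _ => ?_
    simp only [A, conjTranspose_mul, Matrix.mul_assoc]
  have hB : ∑ t, B t * (B t)ᴴ = Ψ (W * Φ (X * Xᴴ) * Wᴴ) := by
    rw [hΨ.apply_eq, hΦ.apply_eq, Fintype.sum_prod_type]
    refine Finset.sum_congr rfl fun j _ => ?_
    simp only [Matrix.mul_sum, Matrix.sum_mul]
    refine Finset.sum_congr rfl fun i _ => ?_
    simp only [B, conjTranspose_mul, Matrix.mul_assoc]
  -- The sum of the positive matrices `A t * (A t)ᴴ` is the projector `N`, so each `A t` has its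
  -- range inside that of `N`.
  have hNA : ∀ t, N * A t = A t := by
    have nn : ∀ t, 0 ≤ (trace ((A t - N * A t)ᴴ * (A t - N * A t))).re := fun t =>
      (Complex.le_def.1 (posSemidef_conjTranspose_mul_self _).trace_nonneg).1
    have hs : ∑ t, (trace ((A t - N * A t)ᴴ * (A t - N * A t))).re = 0 := by
      rw [← Complex.re_sum]
      have : ∀ t, trace ((A t - N * A t)ᴴ * (A t - N * A t)) =
          trace ((1 - N) * (A t * (A t)ᴴ)) := fun t => by
        rw [Matrix.trace_mul_comm]
        have e : A t - N * A t = (1 - N) * A t := by rw [Matrix.sub_mul, Matrix.one_mul]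
        rw [e, conjTranspose_mul, conjTranspose_sub, conjTranspose_one, h1, Matrix.mul_assoc,
          ← Matrix.mul_assoc (A t), Matrix.trace_mul_comm, Matrix.mul_assoc, Matrix.trace_mul_comm,
          Matrix.mul_assoc]
        have e2 : (1 - N) * (1 - N) = 1 - N := by
          simp only [Matrix.sub_mul, Matrix.mul_sub, h2, Matrix.one_mul, Matrix.mul_one]
          abel
        rw [← Matrix.mul_assoc, e2]
      simp only [this]
      rw [← trace_sum, ← Matrix.mul_sum, hA, Matrix.sub_mul, h2, Matrix.one_mul, sub_self]
      simp
    intro t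
    have := eq_zero_of_trace_conjTranspose_mul_self_re_eq_zero
      ((Finset.sum_eq_zero_iff_of_nonneg fun t _ => nn t).1 hs t (Finset.mem_univ t))
    exact (sub_eq_zero.1 this).symm
  have cs := norm_sum_trace_conjTranspose_mul_sq_le A fun t => N * B t
  have e1 : ∑ t, trace ((A t)ᴴ * A t) = 1 := by
    have : ∀ t, trace ((A t)ᴴ * A t) = trace (A t * (A t)ᴴ) := fun t => Matrix.trace_mul_comm _ _
    simp only [this]
    rw [← trace_sum, hA, h3]
  have e2 : ∑ t, trace ((N * B t)ᴴ * (N * B t)) = trace (N * Ψ (W * Φ (X * Xᴴ) * Wᴴ)) := by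
    rw [← hB, Matrix.mul_sum, trace_sum]
    refine Finset.sum_congr rfl fun t _ => ?_
    rw [conjTranspose_mul, h1, Matrix.mul_assoc, ← Matrix.mul_assoc N, h2, Matrix.trace_mul_comm,
      Matrix.mul_assoc]
  -- `N` is absorbed into `A t`; by cyclicity the Kraus operators of `Ψ` then meet as ∑ U†U = 1.
  have e3 : ∑ t, trace ((A t)ᴴ * (N * B t)) = trace (W * Φ (X * Yᴴ)) := by
    have : ∀ t, trace ((A t)ᴴ * (N * B t)) =
        trace (((U t.1)ᴴ * U t.1) * (W * (V t.2 * (X * Yᴴ) * (V t.2)ᴴ))) := fun t => by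
      have : (A t)ᴴ * (N * B t) = (N * A t)ᴴ * B t := by
        rw [conjTranspose_mul N, h1, Matrix.mul_assoc]
      rw [this, hNA]
      simp only [A, B, conjTranspose_mul, Matrix.mul_assoc]
      rw [Matrix.trace_mul_comm]
      simp only [Matrix.mul_assoc]
      rw [Matrix.trace_mul_comm]
      simp only [Matrix.mul_assoc]
    simp only [this]
    rw [hΦ.apply_eq, Fintype.sum_prod_type]
    simp only [← trace_sum, ← Matrix.mul_sum]
    rw [← Matrix.sum_mul, hΨ.sum_eq_one, Matrix.one_mul]
  rw [e1, e2, e3, Complex.one_re, one_mul] at cs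
  exact cs

end SingleKey

/-- The attack that applies the unitary `W` and keeps nothing. -/
theorem exists_unitary_attack {C : Type*} [Fintype C] [DecidableEq C] {W : Matrix C C ℂ}
    (h : Wᴴ * W = 1) :
    ∃ A : Attack C 1, ∀ X, traceSecond C (Fin 1) (A.toMap X) = W * X * Wᴴ := by
  let V : Matrix (C × Fin 1) C ℂ := Matrix.of fun q c => W q.1 c
  have hV : Vᴴ * V = 1 := by
    rw [← h]
    ext i j
    simp [V, Matrix.mul_apply, Fintype.sum_prod_type]
  let Φ : SuperOp C (C × Fin 1) :=
    { toFun := fun X => V * X * Vᴴ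
      map_add' := fun X Y => by rw [Matrix.mul_add, Matrix.add_mul]
      map_smul' := fun z X => by simp }
  refine ⟨⟨Φ, 1, fun _ => V, fun X => by simp [Φ], by simpa using hV⟩, fun X => ?_⟩
  ext i j
  simp [traceSecond, Φ, V, Matrix.mul_apply]

end UncloneableEncryption

/-! ### Secrecy of the averaged ciphertext -/

namespace UncloneableEncryption

open Matrix QuantumCode
open scoped ComplexOrder

variable {K H C : Type*} [Fintype H] [DecidableEq H] [Fintype C] [DecidableEq C]

theorem replicateCol_superposition_mul_add_conjTranspose {H : Type*} [DecidableEq H]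
    (m m' : H) :
    let X := replicateCol Unit (superposition 1 m m').ofLp *
      (replicateCol Unit (superposition (-1) m m').ofLp)ᴴ
    X + Xᴴ = ketbra (ket m) - ketbra (ket m') := by
  have hc : star (((√2 : ℝ) : ℂ)⁻¹) = ((√2 : ℝ) : ℂ)⁻¹ := by
    rw [star_inv₀, Complex.star_def, Complex.conj_ofReal]
  have hk : ∀ i j : H, star (ket i j : ℂ) = ket i j := fun i j => by
    rw [ket_apply]; split_ifs <;> simp
  intro X
  ext i j
  simp only [X, Matrix.add_apply, Matrix.sub_apply, Matrix.mul_apply, conjTranspose_apply,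
    replicateCol_apply, ketbra_apply, superposition_apply, Finset.univ_unique,
    Finset.sum_singleton, star_mul', star_add, star_neg, star_one, hc, hk]
  linear_combination (2 * (ket m i : ℂ) * ket m j - 2 * ket m' i * ket m' j) *
    inv_sqrt_two_mul_self

namespace QuantumCode

variable (S : QuantumCode K H C)

theorem encodeBasis_posSemidef (k : K) (m : H) : (S.encodeBasis k m).PosSemidef := by
  obtain ⟨r, V, hV⟩ := (S.encode_isOp k).exists_isKraus
  exact hV.posSemidef_apply (posSemidef_ketbra _)

theorem trace_encodeBasis (k : K) (m : H) : (S.encodeBasis k m).trace = 1 := by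
  obtain ⟨r, V, hV⟩ := (S.encode_isOp k).exists_isKraus
  rw [encodeBasis, hV.trace_apply, trace_ketbra (norm_ket m)]

theorem decode_bobState_posSemidef {d : ℕ} (A : Attack C d) (k : K) (ψ : EuclideanSpace ℂ H) :
    (S.decode k (S.bobState A k ψ)).PosSemidef := by
  obtain ⟨r, V, hV⟩ := (S.encode_isOp k).exists_isKraus
  obtain ⟨s, B, hB⟩ := A.isOp.exists_isKraus
  obtain ⟨t, U, hU⟩ := (S.decode_isOp k).exists_isKraus
  obtain ⟨D', hD, hD'⟩ := hU.exists_onFirst (e := Fin d)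
  rw [bobState, ← traceSecond_onFirst, ← hD]
  have := hD'.posSemidef_apply (hB.posSemidef_apply (hV.posSemidef_apply (posSemidef_ketbra ψ)))
  have e : ∀ Y : Matrix ((Verdict × H) × Fin d) ((Verdict × H) × Fin d) ℂ,
      traceSecond (Verdict × H) (Fin d) Y =
        ∑ x, Y.submatrix (fun i => (i, x)) (fun i => (i, x)) := fun Y => by
    ext i j
    simp [traceSecond, Matrix.sum_apply]
  rw [e]
  exact posSemidef_sum _ fun x _ => this.submatrix _

/-- The probability that Bob accepts a state orthogonal to `ψ`. -/
noncomputable def badProb {d : ℕ} (A : Attack C d) (k : K) (ψ : EuclideanSpace ℂ H) : ℝ :=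
  (trace (badProj ψ * S.decode k (S.bobState A k ψ))).re

theorem encodeBasis_difference_sq_le {k : K}
    (hk : ∀ ψ : EuclideanSpace ℂ H, ‖ψ‖ = 1 →
      S.decode k (S.encode k (ketbra ψ)) = accProj ⊗ₖ ketbra ψ)
    {m m' : H} (h : m ≠ m') {W : Matrix C C ℂ} (hW : Wᴴ = W) {d : ℕ} {A : Attack C d}
    (hA : ∀ X, traceSecond C (Fin d) (A.toMap X) = W * X * Wᴴ) :
    ((trace (W * (S.encodeBasis k m - S.encodeBasis k m'))).re / 2) ^ 2 ≤
      S.badProb A k (superposition 1 m m') := by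
  obtain ⟨r, V, hV⟩ := (S.encode_isOp k).exists_isKraus
  obtain ⟨t, U, hU⟩ := (S.decode_isOp k).exists_isKraus
  have n1 : ‖superposition 1 m m'‖ = 1 := norm_superposition h (by simp)
  have n2 : ‖superposition (-1) m m'‖ = 1 := norm_superposition h (by simp)
  have key := norm_trace_mul_sq_le hV hU (N := accProj ⊗ₖ ketbra (superposition (-1) m m'))
    (by rw [conjTranspose_kronecker, accProj_conjTranspose, conjTranspose_ketbra])
    (by rw [← mul_kronecker_mul, accProj_mul_self, ketbra_mul_self n2])
    (by rw [trace_kronecker, accProj, trace_ketbra (norm_ket _), trace_ketbra n2, one_mul])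
    (replicateCol Unit (superposition 1 m m').ofLp)
    (replicateCol Unit (superposition (-1) m m').ofLp)
    (by rw [← ketbra_eq_col_mul, hk _ n2]) W
  rw [← ketbra_eq_col_mul, ← hA] at key
  refine le_trans ?_ (key.trans (trace_accProj_kronecker_ketbra_mul_le n2 n1
    (by rw [inner_superposition h]; simp) (S.decode_bobState_posSemidef A k _)))
  set X := replicateCol Unit (superposition 1 m m').ofLp *
    (replicateCol Unit (superposition (-1) m m').ofLp)ᴴ with hX
  have e : (trace (W * (S.encodeBasis k m - S.encodeBasis k m'))).re =
      2 * (trace (W * S.encode k X)).re := by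
    -- The encoding commutes with adjoints and `W` is Hermitian, so the two coherence terms are
    -- conjugate and contribute equal real parts.
    have e1 : trace (W * S.encode k Xᴴ) = star (trace (W * S.encode k X)) := by
      rw [hV.apply_conjTranspose, ← trace_conjTranspose, conjTranspose_mul, hW,
        Matrix.trace_mul_comm]
    rw [encodeBasis, encodeBasis, ← map_sub,
      ← replicateCol_superposition_mul_add_conjTranspose m m', map_add, Matrix.mul_add, trace_add,
      ← hX, e1, Complex.add_re, Complex.star_def, Complex.conj_re]
    ring
  rw [e, mul_div_cancel_left₀ _ two_ne_zero, ← sq_abs]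
  exact pow_le_pow_left₀ (abs_nonneg _) (Complex.abs_re_le_norm _) 2

section Average

variable [Fintype K] [Nonempty K]

/-- This trivial bound serves only the range ε ≥ 1. -/
theorem traceDist_averageState_le_one (m m' : H) :
    traceDist (averageState S.encodeBasis m) (averageState S.encodeBasis m') ≤ 1 := by
  have hcard : (Fintype.card K : ℂ) ≠ 0 := by simp
  have hp : ∀ m, (averageState S.encodeBasis m).PosSemidef := fun m => by
    have : ((Fintype.card K : ℂ))⁻¹ = (((Fintype.card K : ℝ)⁻¹ : ℝ) : ℂ) := by push_cast; rfl
    rw [averageState, this]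
    refine (posSemidef_sum _ fun k _ => S.encodeBasis_posSemidef k m).smul ?_
    exact_mod_cast inv_nonneg.2 (Nat.cast_nonneg (α := ℝ) _)
  have ht : ∀ m, (averageState S.encodeBasis m).trace = 1 := fun m => by
    rw [averageState, trace_smul, trace_sum]
    simp [trace_encodeBasis, hcard]
  obtain ⟨W, h1, h2, h3⟩ := exists_unitary_trace_abs ((hp m).isHermitian.sub (hp m').isHermitian)
  have a := trace_mul_re_mem_Icc_of_involution h1 h2 (hp m) (ht m)
  have b := trace_mul_re_mem_Icc_of_involution h1 h2 (hp m') (ht m')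
  rw [traceDist, h3, Matrix.mul_sub, trace_sub, Complex.sub_re]
  linarith [a.2, b.1]

/-- The sign `W` belongs to the key-averaged difference, so Eve can apply it without knowing the
key. Cauchy-Schwarz over the keys passes from the single-key estimate to the average. -/
theorem traceDist_averageState_sq_le {ε : ℝ} (hS : S.IsAuthentication ε) {m m' : H}
    (h : m ≠ m') :
    traceDist (averageState S.encodeBasis m) (averageState S.encodeBasis m') ^ 2 ≤ ε := by
  have hcard : (0 : ℝ) < Fintype.card K := by exact_mod_cast Fintype.card_pos
  have hZ : (averageState S.encodeBasis m - averageState S.encodeBasis m') =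
      (Fintype.card K : ℂ)⁻¹ • ∑ k, (S.encodeBasis k m - S.encodeBasis k m') := by
    rw [averageState, averageState, ← smul_sub, Finset.sum_sub_distrib]
  have hH : (averageState S.encodeBasis m - averageState S.encodeBasis m').IsHermitian := by
    rw [hZ, IsHermitian, conjTranspose_smul, conjTranspose_sum]
    congr 1
    · simp
    · exact Finset.sum_congr rfl fun k _ =>
        (S.encodeBasis_posSemidef k m).isHermitian.sub (S.encodeBasis_posSemidef k m').isHermitian
  obtain ⟨W, h1, h2, h3⟩ := exists_unitary_trace_abs hH
  obtain ⟨A, hA⟩ := exists_unitary_attack (W := W) (by rw [h1, h2])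
  have hD : traceDist (averageState S.encodeBasis m) (averageState S.encodeBasis m') =
      (Fintype.card K : ℝ)⁻¹ *
        ∑ k, (trace (W * (S.encodeBasis k m - S.encodeBasis k m'))).re / 2 := by
    have : ((Fintype.card K : ℂ))⁻¹ = (((Fintype.card K : ℝ)⁻¹ : ℝ) : ℂ) := by push_cast; rfl
    rw [traceDist, h3, hZ, Matrix.mul_smul, trace_smul, Matrix.mul_sum, trace_sum, this,
      smul_eq_mul, Complex.re_ofReal_mul, Complex.re_sum, ← Finset.sum_div]
    ring
  have hs := hS.sound (superposition 1 m m') (norm_superposition h (by simp)) 1 A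
  have hb : ∑ k, ((trace (W * (S.encodeBasis k m - S.encodeBasis k m'))).re / 2) ^ 2 ≤
      ∑ k, S.badProb A k (superposition 1 m m') :=
    Finset.sum_le_sum fun k _ => S.encodeBasis_difference_sq_le (hS.complete k) h h1 hA
  have hc := sq_sum_le_card_mul_sum_sq (s := (Finset.univ : Finset K))
    (f := fun k => (trace (W * (S.encodeBasis k m - S.encodeBasis k m'))).re / 2)
  rw [Finset.card_univ] at hc
  rw [hD, mul_pow]
  calc _ ≤ (Fintype.card K : ℝ)⁻¹ ^ 2 * (Fintype.card K *
          ∑ k, S.badProb A k (superposition 1 m m')) := by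
        gcongr
        exact hc.trans (mul_le_mul_of_nonneg_left hb hcard.le)
    _ = 1 / (Fintype.card K : ℝ) * ∑ k, S.badProb A k (superposition 1 m m') := by
        field_simp
    _ ≤ ε := hs

end Average

end QuantumCode

end UncloneableEncryption

/-! ### Eve's state in the event of acceptance -/

namespace UncloneableEncryption

open Matrix QuantumCode
open scoped ComplexOrder

variable {K H C : Type*} [Fintype H] [DecidableEq H] [Fintype C] [DecidableEq C]

/-- Here `f` and `g` stand for the accepted amplitudes for inputs `m` and `m'` in one branch. The
first term controls the coherence test; the erased sums are the wrong answers. -/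
theorem sum_norm_sub_swap_sq_le (f g : H → ℂ) {m m' : H} (hm : m ≠ m') :
    ∑ h, ‖f h - g (Equiv.swap m m' h)‖ ^ 2 ≤
      2 * ‖f m + g m - (f m' + g m')‖ ^ 2 + 6 * ∑ h ∈ Finset.univ.erase m, ‖f h‖ ^ 2 +
        6 * ∑ h ∈ Finset.univ.erase m', ‖g h‖ ^ 2 := by
  have two : ∀ x y : ℂ, ‖x - y‖ ^ 2 ≤ 2 * ‖x‖ ^ 2 + 2 * ‖y‖ ^ 2 := fun x y => by
    nlinarith [norm_sub_le x y, norm_nonneg (x - y), sq_nonneg (‖x‖ - ‖y‖)]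
  set q := f m + g m - (f m' + g m') with hq
  -- The correct amplitudes differ by `q` up to two wrong ones. These cost 4 each, and `hrest` adds
  -- 2, whence the constant 6.
  have hfst : ‖f m - g m'‖ ^ 2 ≤ 2 * ‖q‖ ^ 2 + 4 * ‖f m'‖ ^ 2 + 4 * ‖g m‖ ^ 2 := by
    have e : f m - g m' = q - (g m - f m') := by rw [hq]; ring
    have a := two q (g m - f m')
    have b := two (g m) (f m')
    rw [e]
    linarith
  have hrest : ∑ h ∈ Finset.univ.erase m, ‖f h - g (Equiv.swap m m' h)‖ ^ 2 ≤
      2 * ∑ h ∈ Finset.univ.erase m, ‖f h‖ ^ 2 + 2 * ∑ h ∈ Finset.univ.erase m', ‖g h‖ ^ 2 := by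
    have e : ∑ h ∈ Finset.univ.erase m', ‖g h‖ ^ 2 =
        ∑ h ∈ Finset.univ.erase m, ‖g (Equiv.swap m m' h)‖ ^ 2 := by
      have e1 := Finset.add_sum_erase Finset.univ (fun h => ‖g h‖ ^ 2) (Finset.mem_univ m')
      have e2 := Finset.add_sum_erase Finset.univ (fun h => ‖g (Equiv.swap m m' h)‖ ^ 2)
        (Finset.mem_univ m)
      rw [Equiv.sum_comp (Equiv.swap m m') fun h => ‖g h‖ ^ 2] at e2
      simp only [Equiv.swap_apply_left] at e2
      linarith
    rw [e, Finset.mul_sum, Finset.mul_sum, ← Finset.sum_add_distrib]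
    exact Finset.sum_le_sum fun h _ => two _ _
  have hf : ‖f m'‖ ^ 2 ≤ ∑ h ∈ Finset.univ.erase m, ‖f h‖ ^ 2 :=
    Finset.single_le_sum (f := fun h => ‖f h‖ ^ 2) (fun _ _ => sq_nonneg _)
      (Finset.mem_erase.2 ⟨Ne.symm hm, Finset.mem_univ _⟩)
  have hg : ‖g m‖ ^ 2 ≤ ∑ h ∈ Finset.univ.erase m', ‖g h‖ ^ 2 :=
    Finset.single_le_sum (f := fun h => ‖g h‖ ^ 2) (fun _ _ => sq_nonneg _)
      (Finset.mem_erase.2 ⟨hm, Finset.mem_univ _⟩)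
  rw [← Finset.add_sum_erase _ _ (Finset.mem_univ m), Equiv.swap_apply_left]
  linarith

/-- The amplitudes of the accepted branches when `|m⟩` is sent, as a matrix whose rows belong to
Eve's system. -/
def acceptedAmplitude {ι e : Type*} (T : ι → Matrix ((Verdict × H) × e) H ℂ) (m : H) :
    Matrix e (ι × H) ℂ :=
  Matrix.of fun x q => T q.1 ((Verdict.acc, q.2), x) m

section Amplitudes

variable {ι e : Type*} [Fintype ι] [Fintype e] (T : ι → Matrix ((Verdict × H) × e) H ℂ)

theorem mul_ketbra_ket_mul_apply {a : Type*} (M : Matrix a H ℂ) (m : H) (i j : a) :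
    (M * ketbra (ket m) * Mᴴ) i j = M i m * star (M j m) := by
  rw [ketbra, mul_vecMulVec, vecMulVec_mul, ← star_mulVec, vecMulVec_apply]
  simp [ket]

theorem mulVec_superposition_apply {a : Type*} (M : Matrix a H ℂ) (z : ℂ) (m m' : H) (i : a) :
    (M *ᵥ (superposition z m m').ofLp) i = ((√2 : ℝ) : ℂ)⁻¹ * (M i m + z * M i m') := by
  simp [superposition, ket, mulVec_add, mulVec_smul]
  ring

theorem trace_acceptedAmplitude_le_one (hT : ∑ i, (T i)ᴴ * T i = 1) (m : H) :
    (trace ((acceptedAmplitude T m)ᴴ * acceptedAmplitude T m)).re ≤ 1 := by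
  have h1 : (∑ i, ∑ q, ‖T i q m‖ ^ 2 : ℝ) = 1 := by
    have : (∑ i, (T i)ᴴ * T i) m m = 1 := by rw [hT, Matrix.one_apply_eq]
    have h2 : ((∑ i, ∑ q, ‖T i q m‖ ^ 2 : ℝ) : ℂ) = ((1 : ℝ) : ℂ) := by
      rw [Complex.ofReal_one, ← this]
      simp only [Matrix.sum_apply, Matrix.mul_apply, conjTranspose_apply]
      push_cast
      exact Finset.sum_congr rfl fun i _ => Finset.sum_congr rfl fun q _ =>
        (Complex.conj_mul' _).symm
    exact_mod_cast h2
  rw [trace_conjTranspose_mul_self_eq_sum, Complex.ofReal_re, ← h1, Fintype.sum_prod_type]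
  refine Finset.sum_le_sum fun i _ => ?_
  simp only [Fintype.sum_prod_type, sum_verdict, acceptedAmplitude, of_apply]
  exact le_add_of_nonneg_right (by positivity)

theorem trace_badProj_ket_mul_eq (m : H) :
    (trace (badProj (ket m) *
      ∑ i, traceSecond (Verdict × H) e (T i * ketbra (ket m) * (T i)ᴴ))).re =
      ∑ i, ∑ x, ∑ h ∈ Finset.univ.erase m, ‖T i ((Verdict.acc, h), x) m‖ ^ 2 := by
  have e1 : badProj (ket m) = ∑ h ∈ Finset.univ.erase m, accProj ⊗ₖ ketbra (ket h) := by
    rw [badProj, one_sub_ketbra_ket]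
    ext p q
    rw [kroneckerMap_apply, Matrix.sum_apply, Matrix.sum_apply, Finset.mul_sum]
    rfl
  rw [e1, Matrix.mul_sum, trace_sum, Complex.re_sum]
  refine Finset.sum_congr rfl fun i _ => ?_
  rw [Matrix.sum_mul, trace_sum, Complex.re_sum, Finset.sum_comm]
  refine Finset.sum_congr rfl fun h _ => ?_
  rw [trace_accProj_kronecker_ketbra_mul_traceSecond]
  refine Finset.sum_congr rfl fun x _ => ?_
  congr 2
  simp [ket_apply]
  simp [ket]

/-- The bad event for φ+ includes accepting φ-, whose amplitude is half the difference shown.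
Squaring gives 1/4, and 8 = 2 · 4. -/
theorem sum_norm_sub_sq_le_trace_badProj_superposition {m m' : H} (hm : m ≠ m') :
    (∑ i, ∑ x, 2 * ‖T i ((Verdict.acc, m), x) m + T i ((Verdict.acc, m), x) m' -
        (T i ((Verdict.acc, m'), x) m + T i ((Verdict.acc, m'), x) m')‖ ^ 2) ≤
      8 * (trace (badProj (superposition 1 m m') *
        ∑ i, traceSecond (Verdict × H) e
          (T i * ketbra (superposition 1 m m') * (T i)ᴴ))).re := by
  have e1 : ∀ i, traceSecond (Verdict × H) e
      (T i * ketbra (superposition 1 m m') * (T i)ᴴ) = ∑ x,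
        (T i * ketbra (superposition 1 m m') * (T i)ᴴ).submatrix
          (fun j => (j, x)) (fun j => (j, x)) := fun i => by
    ext j l
    simp [traceSecond, Matrix.sum_apply]
  have hpos : (∑ i, traceSecond (Verdict × H) e
      (T i * ketbra (superposition 1 m m') * (T i)ᴴ)).PosSemidef := by
    refine posSemidef_sum _ fun i _ => ?_
    rw [e1]
    exact posSemidef_sum _ fun x _ =>
      ((posSemidef_ketbra _).mul_mul_conjTranspose_same _).submatrix _
  have n1 : ‖superposition 1 m m'‖ = 1 := norm_superposition hm (by simp)
  have n2 : ‖superposition (-1) m m'‖ = 1 := norm_superposition hm (by simp)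
  have key := trace_accProj_kronecker_ketbra_mul_le n2 n1
    (by rw [inner_superposition hm]; simp) hpos
  rw [Matrix.mul_sum, trace_sum, Complex.re_sum] at key
  refine le_trans (le_of_eq ?_) (mul_le_mul_of_nonneg_left key (by norm_num))
  rw [Finset.mul_sum]
  refine Finset.sum_congr rfl fun i _ => ?_
  rw [trace_accProj_kronecker_ketbra_mul_traceSecond, Finset.mul_sum]
  refine Finset.sum_congr rfl fun x _ => ?_
  have hs : ∀ h, star ((superposition (-1) m m' h : ℂ)) =
      ((√2 : ℝ) : ℂ)⁻¹ * ((if h = m then 1 else 0) - if h = m' then 1 else 0) := fun h => by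
    rw [superposition_apply, ket_apply, ket_apply, star_mul', star_inv₀, Complex.star_def,
      Complex.conj_ofReal]
    split_ifs <;> simp
  -- The factor 1/2 is the product of the two normalisations 1/√2 of φ- and φ+.
  have e2 : ∑ h, star ((superposition (-1) m m' h : ℂ)) *
      (T i *ᵥ (superposition 1 m m').ofLp) ((Verdict.acc, h), x) =
      1 / 2 * (T i ((Verdict.acc, m), x) m + T i ((Verdict.acc, m), x) m' -
        (T i ((Verdict.acc, m'), x) m + T i ((Verdict.acc, m'), x) m')) := by
    simp only [hs, mulVec_superposition_apply, mul_sub, sub_mul, Finset.sum_sub_distrib, mul_ite,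
      ite_mul, mul_one, mul_zero, zero_mul, Finset.sum_ite_eq', Finset.mem_univ, if_true, one_mul,
      ← mul_assoc, inv_sqrt_two_mul_self]
  rw [e2, norm_mul, mul_pow]
  norm_num
  ring

theorem traceDist_acceptedAmplitude_sq_le [DecidableEq e] (hT : ∑ i, (T i)ᴴ * T i = 1)
    {m m' : H} (hm : m ≠ m') (bad : EuclideanSpace ℂ H → ℝ)
    (hbad : ∀ ψ, bad ψ = (trace (badProj ψ *
      ∑ i, traceSecond (Verdict × H) e (T i * ketbra ψ * (T i)ᴴ))).re) :
    traceDist (acceptedAmplitude T m * (acceptedAmplitude T m)ᴴ)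
        (acceptedAmplitude T m' * (acceptedAmplitude T m')ᴴ) ^ 2 ≤
      8 * bad (superposition 1 m m') + 6 * bad (ket m) + 6 * bad (ket m') := by
  -- The column index is traced out, so it may be permuted freely: exchanging `m` and `m'` aligns
  -- the correct branches of the two inputs.
  let τ : ι × H ≃ ι × H := (Equiv.refl ι).prodCongr (Equiv.swap m m')
  let V := (acceptedAmplitude T m').submatrix id τ
  have hV : V * Vᴴ = acceptedAmplitude T m' * (acceptedAmplitude T m')ᴴ := by
    rw [conjTranspose_submatrix, submatrix_mul_equiv, submatrix_id_id]
  have hV' : trace (Vᴴ * V) =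
      trace ((acceptedAmplitude T m')ᴴ * acceptedAmplitude T m') := by
    rw [Matrix.trace_mul_comm, hV, Matrix.trace_mul_comm]
  have key := traceDist_mul_conjTranspose_sq_le (acceptedAmplitude T m) V
    (trace_acceptedAmplitude_le_one T hT m) (by
      rw [hV']; exact trace_acceptedAmplitude_le_one T hT m')
  rw [hV, trace_conjTranspose_mul_self_eq_sum, Complex.ofReal_re] at key
  refine key.trans ?_
  rw [hbad, hbad, hbad, trace_badProj_ket_mul_eq, trace_badProj_ket_mul_eq]
  refine le_trans ?_ (add_le_add_left (add_le_add_left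
    (sum_norm_sub_sq_le_trace_badProj_superposition T hm) _) _)
  simp only [Finset.mul_sum, ← Finset.sum_add_distrib, Fintype.sum_prod_type]
  refine Finset.sum_le_sum fun i _ => ?_
  rw [Finset.sum_comm]
  refine Finset.sum_le_sum fun x _ => ?_
  have := sum_norm_sub_swap_sq_le (fun h => T i ((Verdict.acc, h), x) m)
    (fun h => T i ((Verdict.acc, h), x) m') hm
  rw [Finset.mul_sum, Finset.mul_sum] at this
  exact this

end Amplitudes

namespace QuantumCode

variable (S : QuantumCode K H C)

/-- One family `T` describes all inputs at once. This is what lets the test on φ+ relate the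
branches of `m` to those of `m'`. -/
theorem exists_amplitudes {d : ℕ} (A : Attack C d) (k : K) :
    ∃ (ι : Type) (_ : Fintype ι) (T : ι → Matrix ((Verdict × H) × Fin d) H ℂ),
      ∑ i, (T i)ᴴ * T i = 1 ∧
      (∀ ψ, S.badProb A k ψ = (trace (badProj ψ *
        ∑ i, traceSecond (Verdict × H) (Fin d) (T i * ketbra ψ * (T i)ᴴ))).re) ∧
      ∀ m, acceptedState (S.verdict k) A (S.encodeBasis k m) =
        acceptedAmplitude T m * (acceptedAmplitude T m)ᴴ := by
  obtain ⟨r, V, hV⟩ := (S.encode_isOp k).exists_isKraus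
  obtain ⟨s, B, hB⟩ := A.isOp.exists_isKraus
  obtain ⟨t, U, hU⟩ := (S.decode_isOp k).exists_isKraus
  obtain ⟨D', hD, hD'⟩ := hU.exists_onFirst (e := Fin d)
  have hT := hD'.comp (hB.comp hV)
  have hX : ∀ X, onFirst (S.decode k) (A.toMap (S.encode k X)) = _ := fun X =>
    (hD _).symm.trans (hT.apply_eq X)
  refine ⟨_, inferInstance, _, hT.sum_eq_one, fun ψ => ?_, fun m => ?_⟩
  · rw [badProb, bobState, ← traceSecond_onFirst, hX, map_sum]
  · ext x y
    have e : acceptedState (S.verdict k) A (S.encodeBasis k m) x y =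
        ∑ h, onFirst (S.decode k) (A.toMap (S.encode k (ketbra (ket m))))
          ((Verdict.acc, h), x) ((Verdict.acc, h), y) := rfl
    rw [e, Matrix.mul_apply, Fintype.sum_prod_type_right]
    refine Finset.sum_congr rfl fun h _ => ?_
    rw [hX, Matrix.sum_apply]
    refine Finset.sum_congr rfl fun i _ => ?_
    rw [mul_ketbra_ket_mul_apply]
    rfl

/-- Only zero acceptance probability needs an argument: a Gram matrix of trace zero vanishes. -/
theorem acceptProb_smul_residualState {d : ℕ} (A : Attack C d) (k : K) (m : H) :
    acceptProb (S.verdict k) A (S.encodeBasis k m) •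
      residualState (S.verdict k) A (S.encodeBasis k m) =
      acceptedState (S.verdict k) A (S.encodeBasis k m) := by
  by_cases h : acceptProb (S.verdict k) A (S.encodeBasis k m) = 0
  · obtain ⟨ι, _, T, -, -, hT⟩ := S.exists_amplitudes A k
    have : acceptedAmplitude T m = 0 := by
      refine eq_zero_of_trace_conjTranspose_mul_self_re_eq_zero ?_
      rw [Matrix.trace_mul_comm, ← hT]
      exact h
    rw [h, zero_smul, hT, this, Matrix.zero_mul]
  · rw [residualState, smul_inv_smul₀ h]

theorem traceDist_residualState_sq_le {d : ℕ} (A : Attack C d) (k : K) {m m' : H} (h : m ≠ m') :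
    traceDist
        (acceptProb (S.verdict k) A (S.encodeBasis k m) •
          residualState (S.verdict k) A (S.encodeBasis k m))
        (acceptProb (S.verdict k) A (S.encodeBasis k m') •
          residualState (S.verdict k) A (S.encodeBasis k m')) ^ 2 ≤
      8 * S.badProb A k (superposition 1 m m') + 6 * S.badProb A k (ket m) +
        6 * S.badProb A k (ket m') := by
  obtain ⟨ι, _, T, hT, hbad, hacc⟩ := S.exists_amplitudes A k
  rw [acceptProb_smul_residualState, acceptProb_smul_residualState, hacc, hacc]
  exact traceDist_acceptedAmplitude_sq_le T hT h _ hbad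

end QuantumCode

/-- Chebyshev's inequality for the uniform distribution. -/
theorem one_sub_le_card_subtype_div [Fintype K] [Nonempty K] (f : K → ℝ) {δ : ℝ}
    (hδ : 0 ≤ δ) (h : ∑ k, f k ^ 2 ≤ Fintype.card K * δ ^ 3) :
    1 - δ ≤ (Nat.card {k : K // f k ≤ δ} : ℝ) / Fintype.card K := by
  classical
  have hcard : (0 : ℝ) < Fintype.card K := by exact_mod_cast Fintype.card_pos
  rw [Nat.card_eq_fintype_card, Fintype.card_subtype, le_div_iff₀ hcard]
  have hsum : ((Finset.univ.filter fun k => f k ≤ δ).card : ℝ) +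
      (Finset.univ.filter fun k => ¬ f k ≤ δ).card = Fintype.card K := by
    exact_mod_cast Finset.card_filter_add_card_filter_not (s := (Finset.univ : Finset K))
      (fun k => f k ≤ δ)
  -- For δ = 0 one cannot cancel δ²; the hypothesis then forces every `f k` to vanish.
  rcases hδ.eq_or_lt with rfl | hpos
  · have hz : ∀ k, f k = 0 := fun k => by
      have := (Finset.sum_eq_zero_iff_of_nonneg fun k _ => sq_nonneg (f k)).1
        (le_antisymm (by simpa using h) (Finset.sum_nonneg fun k _ => sq_nonneg (f k))) k
        (Finset.mem_univ k)
      simpa using this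
    simp [hz]
  · have hb : ((Finset.univ.filter fun k => ¬ f k ≤ δ).card : ℝ) * δ ^ 2 ≤ ∑ k, f k ^ 2 := by
      rw [← nsmul_eq_mul]
      refine (Finset.card_nsmul_le_sum _ (fun k => f k ^ 2) _ fun k hk => ?_).trans
        (Finset.sum_le_sum_of_subset_of_nonneg (Finset.filter_subset _ _)
          fun k _ _ => sq_nonneg _)
      exact pow_le_pow_left₀ hδ (not_le.1 (Finset.mem_filter.1 hk).2).le 2
    have : ((Finset.univ.filter fun k => ¬ f k ≤ δ).card : ℝ) ≤ Fintype.card K * δ := by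
      refine le_of_mul_le_mul_right (hb.trans (h.trans (le_of_eq ?_))) (pow_pos hpos 2)
      ring
    linarith

end UncloneableEncryption

/-! ### Exponents and constants -/

theorem theorem5 {K H C : Type*} [Fintype K] [Nonempty K] [Fintype H] [DecidableEq H]
    [Fintype C] [DecidableEq C] (S : UncloneableEncryption.QuantumCode K H C)
    (ε : ℝ) (hε : 0 ≤ ε) (hS : S.IsAuthentication ε) :
    UncloneableEncryption.IsUncloneableEncryption S.encodeBasis S.verdict
      (15 / 2 * ε ^ (1 / 6 : ℝ)) := by
  set t : ℝ := ε ^ (1 / 6 : ℝ) with ht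
  have ht0 : 0 ≤ t := Real.rpow_nonneg hε _
  have ht6 : ε = t ^ 6 := by
    rw [ht, ← Real.rpow_natCast, ← Real.rpow_mul hε]
    norm_num
  constructor
  · intro m m' h
    have h1 := S.traceDist_averageState_le_one m m'
    have h2 := S.traceDist_averageState_sq_le hS h
    rcases le_or_gt 1 t with h3 | h3
    · linarith
    -- The available bound is √ε = t³; the weaker bound t already suffices.
    · have : t ^ 6 ≤ t ^ 2 := pow_le_pow_of_le_one ht0 h3.le (by norm_num)
      have := abs_le_of_sq_le_sq (h2.trans (ht6.trans_le this)) ht0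
      linarith [le_abs_self (UncloneableEncryption.traceDist
        (UncloneableEncryption.averageState S.encodeBasis m)
        (UncloneableEncryption.averageState S.encodeBasis m'))]
  · intro m m' h d A
    -- For t ≥ 1 the error exceeds 1 and the required fraction of keys is negative.
    rcases le_or_gt 1 t with h3 | h3
    · exact le_trans (by linarith) (div_nonneg (Nat.cast_nonneg _) (Nat.cast_nonneg _))
    refine UncloneableEncryption.one_sub_le_card_subtype_div _ (by positivity) ?_
    refine (Finset.sum_le_sum fun k _ => S.traceDist_residualState_sq_le A k h).trans ?_
    have hcard : (0 : ℝ) < Fintype.card K := by exact_mod_cast Fintype.card_pos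
    have hs : ∀ ψ : EuclideanSpace ℂ H, ‖ψ‖ = 1 →
        ∑ k, S.badProb A k ψ ≤ Fintype.card K * ε := fun ψ hψ => by
      have := hS.sound ψ hψ d A
      rw [one_div, inv_mul_le_iff₀ hcard] at this
      exact this
    have a := hs _ (UncloneableEncryption.norm_superposition h (z := 1) (by simp))
    have b := hs _ (UncloneableEncryption.norm_ket m)
    have c := hs _ (UncloneableEncryption.norm_ket m')
    rw [Finset.sum_add_distrib, Finset.sum_add_distrib, ← Finset.mul_sum, ← Finset.mul_sum,
      ← Finset.mul_sum]
    have h6 : t ^ 6 ≤ t ^ 3 := pow_le_pow_of_le_one ht0 h3.le (by norm_num)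
    -- Here 20 = 8 + 6 + 6, and Chebyshev's inequality needs 20ε ≤ δ³. There is ample room, since
    -- (15/2)³ > 421 and t⁶ ≤ t³.
    have h7 : 20 * ε ≤ (15 / 2 * t) ^ 3 := by
      rw [ht6, mul_pow]
      nlinarith [pow_nonneg ht0 3]
    have := mul_le_mul_of_nonneg_left h7 hcard.le
    linarith
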